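/- Let $1\to N\to \hat G\to Q\to 1$ be a central extension of a finite abelian group $Q$ by a finitely generated abelian group $N$, and let $\mathbb{k}$ be an algebraically closed field with $\operatorname{char}\mathbb{k}\notin[1,|Q|]$. Put $H=\mathbb{k}\hat G$ and $C=\mathbb{k}N$, regarded as a central Hopf subalgebra of $H$, and let $\mathfrak{m}_{\bar\varepsilon}\subset C$ be the kernel of the counit of $C$. For a Hopf algebra $K$ over $\mathbb{k}$ let $G(K^\circ)$ be the group, under convolution, of algebra homomorphisms $K\to\mathbb{k}$ (characters). (1) Let $\mathfrak{m}$ be a maximal ideal of $C$ and $V$ an irreducible $H/\mathfrak{m}H$-module. Then $n=\dim_{\mathbb{k}}V$ is finite, $n^2$ divides $|Q|$, and $H/\mathfrak{m}H\cong M_n(\mathbb{k})^{\oplus |Q|/n^2}$ as $\mathbb{k}$-algebras. (2) Every irreducible $H$-module $V$ is maximally stable: $V$ is finite-dimensional, and the number of characters $\chi$ of $H$ that vanish on $\mathfrak{m}_{\bar\varepsilon}$ and satisfy $\chi\otimes_{\mathbb{k}} V\cong V$ as $H$-modules is finite and equal to $(\dim_{\mathbb{k}} V)^2$. (3) For $\chi\in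 G(H^\circ)$ let $W_l(\chi)(h)=\sum\chi(h_1)h_2$ and $W_r(\chi)(h)=\sum\chi(h_2)h_1$ be the left and right winding automorphisms of $H$, and let $\operatorname{Aut}_{\mathbb{k}\text{-}\mathrm{Alg}}(H,C)$ be the group of $\mathbb{k}$-algebra automorphisms $\varphi$ of $H$ with $\varphi(C)=C$. There is a subgroup $A$ of $N$, automatically normal in $\hat G$, such that $\hat G/A$ is abelian and $$\mathcal{O}:=\operatorname{Aut}_{\mathbb{k}\text{-}\mathrm{Alg}}(H,C)\cdot\mathfrak{m}_{\bar\varepsilon}=W_l(G(H^\circ))\cdot\mathfrak{m}_{\bar\varepsilon}=W_r(G(H^\circ))\cdot\mathfrak{m}_{\bar\varepsilon};$$ moreover, identifying a character $\chi$ of $C$ with its kernel, $\mathcal{O}$ is a subgroup of $G(C^\circ)$, and composition with the projection $C\to\mathbb{k}[N/A]$ is a group isomorphism from $G((\mathbb{k}[N/A])^\circ)$ onto $\mathcal{O}$. -/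

import Mathlib

open scoped TensorProduct

noncomputable section

namespace Winding

variable {k : Type*} [Field k]

/-- `W_l(χ)(h) = ∑ χ(h₁) h₂`, as an algebra endomorphism of the bialgebra `H`. -/
def leftHom {H : Type*} [Ring H] [Bialgebra k H] (χ : H →ₐ[k] k) : H →ₐ[k] H :=
  ((Algebra.TensorProduct.lid k H).toAlgHom.comp
    (Algebra.TensorProduct.map χ (AlgHom.id k H))).comp (Bialgebra.comulAlgHom k H)

/-- `W_r(χ)(h) = ∑ χ(h₂) h₁`, as an algebra endomorphism of the bialgebra `H`. -/
def rightHom {H : Type*} [Ring H] [Bialgebra k H] (χ : H →ₐ[k] k) : H →ₐ[k] H :=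
  ((Algebra.TensorProduct.rid k k H).toAlgHom.comp
    (Algebra.TensorProduct.map (AlgHom.id k H) χ)).comp (Bialgebra.comulAlgHom k H)

variable {G : Type*} [Group G]

theorem leftHom_single (χ : MonoidAlgebra k G →ₐ[k] k) (g : G) (a : k) :
    leftHom χ (MonoidAlgebra.single g a) =
      MonoidAlgebra.single g (χ (MonoidAlgebra.single g 1) * a) := by
  simp [leftHom]

theorem rightHom_single (χ : MonoidAlgebra k G →ₐ[k] k) (g : G) (a : k) :
    rightHom χ (MonoidAlgebra.single g a) =
      MonoidAlgebra.single g (χ (MonoidAlgebra.single g 1) * a) := by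
  have h : MonoidAlgebra.single g a = a • (MonoidAlgebra.single g 1 : MonoidAlgebra k G) := by
    simp
  rw [h, map_smul]
  simp [rightHom, mul_comm]

/-- The character `g ↦ χ(g⁻¹)`, the convolution inverse of `χ`. -/
def invChar (χ : MonoidAlgebra k G →ₐ[k] k) : MonoidAlgebra k G →ₐ[k] k :=
  MonoidAlgebra.lift k k G
    { toFun := fun g => χ (MonoidAlgebra.single g⁻¹ 1)
      map_one' := by rw [inv_one, ← MonoidAlgebra.one_def, map_one]
      map_mul' := fun g h => by
        rw [← map_mul, MonoidAlgebra.single_mul_single, one_mul, mul_inv_rev, ← one_mul (1 : k),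
          ← MonoidAlgebra.single_mul_single, map_mul, mul_comm, ← map_mul]
        simp [MonoidAlgebra.single_mul_single] }

theorem invChar_single (χ : MonoidAlgebra k G →ₐ[k] k) (g : G) :
    invChar χ (MonoidAlgebra.single g 1) = χ (MonoidAlgebra.single g⁻¹ 1) := by
  simp [invChar]

theorem char_mul_inv (χ : MonoidAlgebra k G →ₐ[k] k) (g : G) :
    χ (MonoidAlgebra.single g 1) * χ (MonoidAlgebra.single g⁻¹ 1) = 1 := by
  rw [← map_mul, MonoidAlgebra.single_mul_single, mul_inv_cancel, one_mul,
    ← MonoidAlgebra.one_def, map_one]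

/-- The left winding automorphism `W_l(χ)` of the group algebra. -/
def leftAut (χ : MonoidAlgebra k G →ₐ[k] k) : MonoidAlgebra k G ≃ₐ[k] MonoidAlgebra k G :=
  AlgEquiv.ofAlgHom (leftHom χ) (leftHom (invChar χ))
    (by
      refine MonoidAlgebra.algHom_ext (fun g => ?_) (Subsingleton.elim _ _)
      simp only [AlgHom.comp_apply, leftHom_single, invChar_single, mul_one, char_mul_inv,
        AlgHom.id_apply])
    (by
      refine MonoidAlgebra.algHom_ext (fun g => ?_) (Subsingleton.elim _ _)
      simp only [AlgHom.comp_apply, leftHom_single, invChar_single, mul_one, AlgHom.id_apply,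
        mul_comm _ (χ (MonoidAlgebra.single g 1)), char_mul_inv])

/-- The right winding automorphism `W_r(χ)` of the group algebra. -/
def rightAut (χ : MonoidAlgebra k G →ₐ[k] k) : MonoidAlgebra k G ≃ₐ[k] MonoidAlgebra k G :=
  AlgEquiv.ofAlgHom (rightHom χ) (rightHom (invChar χ))
    (by
      refine MonoidAlgebra.algHom_ext (fun g => ?_) (Subsingleton.elim _ _)
      simp only [AlgHom.comp_apply, rightHom_single, invChar_single, mul_one, char_mul_inv,
        AlgHom.id_apply])
    (by
      refine MonoidAlgebra.algHom_ext (fun g => ?_) (Subsingleton.elim _ _)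
      simp only [AlgHom.comp_apply, rightHom_single, invChar_single, mul_one, AlgHom.id_apply,
        mul_comm _ (χ (MonoidAlgebra.single g 1)), char_mul_inv])

end Winding

/-- The tensor product of two representations of a bialgebra, through the comultiplication:
`h` acts on `W ⊗ V` as `∑ ρ(h₁) ⊗ σ(h₂)`. -/
def tensorRep {k H W V : Type*} [Field k] [Ring H] [Bialgebra k H]
    [AddCommGroup W] [Module k W] [AddCommGroup V] [Module k V]
    (ρ : H →ₐ[k] Module.End k W) (σ : H →ₐ[k] Module.End k V) :
    H →ₐ[k] Module.End k (W ⊗[k] V) :=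
  (Module.endTensorEndAlgHom (R := k) (S := k) (A := k) (M := W) (N := V)).comp
    ((Algebra.TensorProduct.map ρ σ).comp (Bialgebra.comulAlgHom k H))

/-- The augmentation ideal of the group algebra `k[N]`: the kernel of its counit. -/
def augIdeal (k N : Type*) [Field k] [CommGroup N] : Ideal (MonoidAlgebra k N) :=
  RingHom.ker (Bialgebra.counitAlgHom k (MonoidAlgebra k N))

/-- A central extension `1 → N → G → Q → 1`. -/
structure CentralExtension (N G Q : Type*) [CommGroup N] [Group G] [Group Q]
    extends GroupExtension N G Q where
  /-- The image of `N` is central. -/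
  inl_range_le_center : inl.range ≤ Subgroup.center G

namespace CentralExtension

variable {N G Q : Type*} [CommGroup N] [Group G] [Group Q] (E : CentralExtension N G Q)

/-- The image in `G` of a subgroup of `N` is normal, being central. -/
instance normal_map (A : Subgroup N) : (A.map E.inl).Normal where
  conj_mem := by
    rintro _ ⟨a, ha, rfl⟩ g
    have h := Subgroup.mem_center_iff.1 (E.inl_range_le_center ⟨a, rfl⟩) g
    rw [h, mul_inv_cancel_right]
    exact ⟨a, ha, rfl⟩

variable (k : Type*) [Field k]

/-- The inclusion of `C = k[N]` in `H = k[G]`. -/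
def incl : MonoidAlgebra k N →ₐ[k] MonoidAlgebra k G :=
  MonoidAlgebra.mapDomainAlgHom k k E.inl

theorem incl_comm (c : MonoidAlgebra k N) (h : MonoidAlgebra k G) :
    E.incl k c * h = h * E.incl k c := by
  induction c using MonoidAlgebra.induction_on with
  | of n =>
    induction h using MonoidAlgebra.induction_on with
    | of g =>
      have hn := Subgroup.mem_center_iff.1 (E.inl_range_le_center ⟨n, rfl⟩) g
      simp [incl, MonoidAlgebra.of_apply, MonoidAlgebra.single_mul_single, hn]
    | add x y hx hy => rw [mul_add, add_mul, hx, hy]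
    | smul r x hx => rw [mul_smul_comm, smul_mul_assoc, hx]
  | add x y hx hy => rw [map_add, mul_add, add_mul, hx, hy]
  | smul r x hx => rw [map_smul, mul_smul_comm, smul_mul_assoc, hx]

variable {k}

/-- The ideal `m H` of `H = k[G]` generated by an ideal `m` of `C = k[N]`. -/
def fiberIdeal (m : Ideal (MonoidAlgebra k N)) : Ideal (MonoidAlgebra k G) :=
  Ideal.map (E.incl k) m

instance fiberIdeal_isTwoSided (m : Ideal (MonoidAlgebra k N)) :
    (E.fiberIdeal m).IsTwoSided where
  mul_mem_of_left {a} b ha := by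
    induction ha using Submodule.span_induction with
    | mem x hx =>
      obtain ⟨c, hc, rfl⟩ := hx
      rw [E.incl_comm k c b]
      exact Ideal.mul_mem_left _ _ (Ideal.mem_map_of_mem _ hc)
    | zero => rw [zero_mul]; exact zero_mem _
    | add x y _ _ hx hy => rw [add_mul]; exact add_mem hx hy
    | smul r x _ hx =>
      rw [smul_eq_mul, mul_assoc]
      exact Ideal.mul_mem_left _ _ hx

/-- The fiber algebra `H / m H`. -/
abbrev Fiber (m : Ideal (MonoidAlgebra k N)) : Type _ :=
  MonoidAlgebra k G ⧸ E.fiberIdeal m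

variable (k) in
/-- The characters of `H` which vanish on the augmentation ideal of `C`. -/
def identityChars : Set (MonoidAlgebra k G →ₐ[k] k) :=
  {χ | ∀ c ∈ augIdeal k N, χ (E.incl k c) = 0}

variable (k) in
/-- The stabilizer of an `H`-module `V`: the characters `χ` of `H` vanishing on the augmentation
ideal of `C` such that `χ ⊗ V` and `V` are isomorphic `H`-modules. -/
def stab (V : Type*) [AddCommGroup V] [Module k V] [Module (MonoidAlgebra k G) V]
    [IsScalarTower k (MonoidAlgebra k G) V] : Set (MonoidAlgebra k G →ₐ[k] k) :=
  {χ | χ ∈ E.identityChars k ∧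
    ∃ f : (k ⊗[k] V) ≃ₗ[k] V, ∀ (h : MonoidAlgebra k G) (t : k ⊗[k] V),
      f (tensorRep ((Algebra.lmul k k).comp χ) (Algebra.lsmul k k V) h t) = h • f t}

variable (k) in
/-- `V` is maximally stable if its stabilizer has order `(dim V)²`. -/
def MaximallyStable (V : Type*) [AddCommGroup V] [Module k V] [Module (MonoidAlgebra k G) V]
    [IsScalarTower k (MonoidAlgebra k G) V] : Prop :=
  FiniteDimensional k V ∧ (E.stab k V).Finite ∧
    (E.stab k V).ncard = Module.finrank k V ^ 2

variable (k) in
/-- The group of algebra automorphisms of `H = k[G]` which map `C = k[N]` onto itself. -/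
def relAut : Subgroup (MonoidAlgebra k G ≃ₐ[k] MonoidAlgebra k G) where
  carrier := {φ | φ '' Set.range (E.incl k) = Set.range (E.incl k)}
  one_mem' := by
    change id '' _ = _
    exact Set.image_id _
  mul_mem' {φ ψ} hφ hψ := by
    change (φ ∘ ψ) '' _ = _
    rw [Set.image_comp, hψ, hφ]
  inv_mem' {φ} hφ := by
    change φ.symm '' _ = _
    conv_lhs => rw [← hφ]
    rw [← Set.image_comp]
    convert Set.image_id _
    ext x
    simp

/-- The orbit of an ideal `m` of `C` under a set `S` of automorphisms of `H`: all ideals `m'`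
of `C` with `m' = φ(m)` inside `H` for some `φ ∈ S`. -/
def orbit (S : Set (MonoidAlgebra k G ≃ₐ[k] MonoidAlgebra k G))
    (m : Ideal (MonoidAlgebra k N)) : Set (Ideal (MonoidAlgebra k N)) :=
  {m' | ∃ φ ∈ S, E.incl k '' (m' : Set (MonoidAlgebra k N)) =
    φ '' (E.incl k '' (m : Set (MonoidAlgebra k N)))}

end CentralExtension

end

/-! Fibers. Coset representatives of `N` span `H/mH`, because `C/m = k` by the Nullstellensatz.
Twisting `V` by the characters of `Q` yields surjections of `H/mH` onto `End V`. As `|Q|` is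
invertible, characters of `Q` separate the coset representatives, so no nontrivial combination of
them is killed by all twists (`coeff_smul_eq_zero_of_twist_eq_zero`). Hence the representatives form
a basis, the dimension is `|Q|`, and an algebra separated by maps onto one matrix algebra is a power
of it.

Stability. `N` acts on a simple `V` by scalars, so `V` is finite-dimensional. An isomorphism `χ ⊗ V
≅ V` amounts to an invertible `T` with `g T g⁻¹ = χ(g) T`. Choosing one `T` per `χ` gives
eigenvectors with distinct characters, hence independent ones. They span: each `g` acts as such an
operator, for its commutator character, and group elements span `End V` by Burnside. So the
stabilizer has `dim End V` elements.

Orbit. `φ(ker ε)` is the kernel of `ε ∘ φ⁻¹` on `C`, and `ε ∘ φ⁻¹` is a character of `H`; winding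
automorphisms already produce every character. All orbits thus consist of kernels of restrictions to
`C` of characters of `H`. With `A = N ∩ [G, G]`, these restrictions are exactly the characters of
`N/A`: `N/A` embeds in the abelianization of `G`, and `kˣ` is divisible. -/

/-! ### General algebra: separating maps, characters of abelian groups, Burnside. -/

/-- A finite-dimensional algebra over an algebraically closed field which is separated by
surjections onto `Mₙ(k)` is a power of `Mₙ(k)`. -/
theorem exists_algEquiv_pi_matrix_of_separating {k F ι : Type*} [Field k] [IsAlgClosed k] [Ring F]
    [Algebra k F] [FiniteDimensional k F] {n : ℕ} [NeZero n]
    (ψ : ι → F →ₐ[k] Matrix (Fin n) (Fin n) k) (hψ : ∀ i, Function.Surjective (ψ i))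
    (hsep : ∀ x, (∀ i, ψ i x = 0) → x = 0) :
    ∃ r : ℕ, r * n ^ 2 = Module.finrank k F ∧
      Nonempty (F ≃ₐ[k] (Fin r → Matrix (Fin n) (Fin n) k)) := by
  have : IsArtinianRing F := .of_finite k F
  have : IsSemisimpleRing F := by
    rw [IsArtinianRing.isSemisimpleRing_iff_jacobson, eq_bot_iff]
    intro x hx
    refine hsep x fun i => ?_
    have : RingHomSurjective (ψ i).toRingHom := ⟨hψ i⟩
    have h := Ring.le_comap_jacobson (ψ i).toRingHom hx
    have h0 : Ring.jacobson (Matrix (Fin n) (Fin n) k) = ⊥ :=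
      IsSemisimpleModule.jacobson_eq_bot _ _
    rw [h0] at h
    exact h
  obtain ⟨r, d, hd, ⟨e⟩⟩ := IsSemisimpleRing.exists_algEquiv_pi_matrix_of_isAlgClosed k F
  have hdn : ∀ j, d j = n := by
    intro j
    have := hd j
    -- The central idempotent of block `j` survives under some `ψ i`; its image is a nonzero central
    -- idempotent of a simple ring, hence `1`. So `ψ i` restricts to a unital isomorphism from this
    -- block onto `Mₙ(k)`.
    set z : Π i, Matrix (Fin (d i)) (Fin (d i)) k := Pi.single j 1 with hz
    have hzz : z * z = z := by rw [hz, ← Pi.single_mul, one_mul]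
    have hz0 : z ≠ 0 := by simp [hz]
    have hzc : ∀ x, z * x = Pi.single j (x j) := by
      intro x; ext i : 1
      by_cases h : i = j
      · subst h; simp [hz]
      · simp [hz, h]
    have hzc' : ∀ x, x * z = Pi.single j (x j) := by
      intro x; ext i : 1
      by_cases h : i = j
      · subst h; simp [hz]
      · simp [hz, h]
    obtain ⟨i, hi⟩ : ∃ i, ψ i (e.symm z) ≠ 0 := by
      by_contra! h
      exact hz0 (by simpa using hsep _ h)
    let φ : (Π i, Matrix (Fin (d i)) (Fin (d i)) k) →ₐ[k] Matrix (Fin n) (Fin n) k :=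
      (ψ i).comp e.symm.toAlgHom
    have hφ : Function.Surjective φ := (hψ i).comp e.symm.surjective
    have hφz : φ z = 1 := by
      have hc : φ z ∈ Subring.center (Matrix (Fin n) (Fin n) k) := by
        rw [Subring.mem_center_iff]
        intro g
        obtain ⟨x, rfl⟩ := hφ g
        rw [← map_mul, ← map_mul, hzc, hzc']
      have hf := IsSimpleRing.isField_center (Matrix (Fin n) (Fin n) k)
      have hne : (⟨φ z, hc⟩ : Subring.center (Matrix (Fin n) (Fin n) k)) ≠ 0 := by
        intro h; exact hi congr(($h).1)
      obtain ⟨w, hw⟩ := hf.mul_inv_cancel hne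
      have hw' : φ z * w = 1 := congr(($hw).1)
      calc φ z = φ z * (φ z * w) := by rw [hw', mul_one]
        _ = φ (z * z) * w := by rw [map_mul, mul_assoc]
        _ = 1 := by rw [hzz, hw']
    let θ : Matrix (Fin (d j)) (Fin (d j)) k →ₐ[k] Matrix (Fin n) (Fin n) k :=
      AlgHom.ofLinearMap (φ.toLinearMap ∘ₗ LinearMap.single k (fun i => Matrix (Fin (d i)) (Fin (d i)) k) j) hφz (by
        intro x y
        simp only [LinearMap.comp_apply, LinearMap.single_apply, Pi.single_mul]
        exact map_mul φ _ _)
    have hθ : Function.Bijective θ := by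
      refine ⟨θ.toRingHom.injective, fun y => ?_⟩
      obtain ⟨x, rfl⟩ := hφ y
      refine ⟨x j, ?_⟩
      change φ (Pi.single j (x j)) = φ x
      rw [← hzc', map_mul, hφz, mul_one]
    have := (LinearEquiv.ofBijective θ.toLinearMap hθ).finrank_eq
    simp only [Module.finrank_matrix, Fintype.card_fin, Module.finrank_self, mul_one] at this
    exact Nat.mul_self_inj.1 this
  obtain rfl : d = fun _ => n := funext hdn
  refine ⟨r, ?_, ⟨e⟩⟩
  rw [e.toLinearEquiv.finrank_eq]
  simp [sq, Module.finrank_pi_fintype, Module.finrank_matrix]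

/-- If `∑ q, η q • v q = 0` for all the characters `η` of a finite abelian group whose order is
invertible, then `v = 0`. -/
theorem eq_zero_of_forall_sum_char_smul {k Q M : Type*} [Field k] [IsAlgClosed k] [CommGroup Q]
    [Fintype Q] [AddCommGroup M] [Module k M] (hQ : (Nat.card Q : k) ≠ 0) (v : Q → M)
    (hv : ∀ η : Q →* kˣ, ∑ q, (η q : k) • v q = 0) (q : Q) : v q = 0 := by
  have : NeZero (Monoid.exponent Q : k) := ⟨fun h => hQ <| by
    obtain ⟨c, hc⟩ := Group.exponent_dvd_nat_card (G := Q)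
    rw [hc, Nat.cast_mul, h, zero_mul]⟩
  have : NeZero (Monoid.exponent Q) := NeZero.of_neZero_natCast k
  -- Each `q` becomes a character of the dual group. These are distinct because `k` has enough roots
  -- of unity, so Dedekind's independence applies.
  let ev : Q → ((Q →* kˣ) →* k) := fun q => (Units.coeHom k).comp (MonoidHom.eval q)
  have hev : Function.Injective ev := by
    intro q q' h
    rw [← CommGroup.forall_apply_eq_apply_iff Q (M := k)]
    intro φ
    exact Units.ext (DFunLike.congr_fun h φ)
  have hli := (linearIndependent_monoidHom (Q →* kˣ) k).comp ev hev
  rw [Fintype.linearIndependent_iff] at hli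
  rw [← Module.forall_dual_apply_eq_zero_iff k]
  intro f
  refine hli (fun q => f (v q)) ?_ q
  ext η
  have := congr(f $(hv η))
  simpa [ev, mul_comm] using this

/-- Every element of a finitely generated algebra over an algebraically closed field is constant
modulo a maximal ideal. -/
theorem exists_sub_algebraMap_mem_of_isMaximal {k C : Type*} [Field k] [IsAlgClosed k] [CommRing C]
    [Algebra k C] [Algebra.FiniteType k C] (m : Ideal C) [m.IsMaximal] (c : C) :
    ∃ a : k, c - algebraMap k C a ∈ m := by
  let _ := Ideal.Quotient.field m
  have := finite_of_finite_type_of_isJacobsonRing k (C ⧸ m)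
  obtain ⟨a, ha⟩ := (IsAlgClosed.algebraMap_bijective_of_isIntegral (k := k) (K := C ⧸ m)).2
    (Ideal.Quotient.mk m c)
  exact ⟨a, Ideal.Quotient.eq.1 (ha.symm.trans (by rfl))⟩

/-- Characters with values in the multiplicative group of an algebraically closed field extend along
injective homomorphisms of abelian groups. -/
theorem exists_extend_char {k A B : Type*} [Field k] [IsAlgClosed k] [CommGroup A] [CommGroup B]
    (i : A →* B) (hi : Function.Injective i) (μ : A →* kˣ) : ∃ χ : B →* kˣ, χ.comp i = μ := by
  have hdiv : ∀ {n : ℕ}, n ≠ 0 → Function.Surjective (fun a : Additive kˣ => n • a) := by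
    intro n hn a
    obtain ⟨z, hz⟩ := IsAlgClosed.exists_pow_nat_eq ((Additive.toMul a : kˣ) : k)
      (Nat.pos_of_ne_zero hn)
    have hz0 : z ≠ 0 := by
      rintro rfl
      rw [zero_pow hn] at hz
      exact (Additive.toMul a).ne_zero hz.symm
    exact ⟨Additive.ofMul (Units.mk0 z hz0), Additive.toMul.injective (Units.ext hz)⟩
  -- Roots exist in `k`, so `kˣ` is divisible, hence injective as a `ℤ`-module by Baer's criterion.
  let _ : DivisibleBy (Additive kˣ) ℕ := divisibleByOfSMulRightSurj _ _ hdiv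
  let _ : DivisibleBy (Additive kˣ) ℤ := AddGroup.divisibleByIntOfDivisibleByNat _
  obtain ⟨h, hh⟩ := (Module.Baer.of_divisible (Additive kˣ)).extension_property_addMonoidHom
    (MonoidHom.toAdditive i) hi (MonoidHom.toAdditive μ)
  exact ⟨MonoidHom.toAdditive.symm h, MonoidHom.toAdditive.injective hh⟩

/-- Burnside's theorem: an algebra acts on a finite-dimensional simple module over an algebraically
closed field by all the linear endomorphisms. -/
theorem lsmul_surjective_of_isSimpleModule {k H V : Type*} [Field k] [IsAlgClosed k] [Ring H]
    [Algebra k H] [AddCommGroup V] [Module k V] [Module H V] [IsScalarTower k H V]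
    [IsSimpleModule H V] [FiniteDimensional k V] :
    Function.Surjective (Algebra.lsmul k k V : H →ₐ[k] Module.End k V) := by
  intro f
  -- By Schur `End_H V = k`, so every `k`-linear `f` qualifies for the density theorem, applied on a
  -- basis.
  let f' : Module.End (Module.End H V) V :=
    { toFun := f
      map_add' := map_add f
      map_smul' := fun a v => by
        obtain ⟨c, rfl⟩ := (IsSimpleModule.algebraMap_end_bijective_of_isAlgClosed (A := H) k).2 a
        simp }
  classical
  obtain ⟨h, hh⟩ := jacobson_density f' (Finset.univ.image (Module.finBasis k V))
  refine ⟨h, (Module.finBasis k V).ext fun i => ?_⟩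
  exact (hh _ (Finset.mem_image_of_mem _ (Finset.mem_univ i))).symm

/-! ### Coset representatives and the scalar action of `N` on simple modules. -/

namespace CentralExtension

variable {k N G Q : Type*} [Field k] [CommGroup N] [Group G] [CommGroup Q]
  (E : CentralExtension N G Q)

/-- A set-theoretic section of the projection `G → Q`. -/
noncomputable def sec (q : Q) : G := Function.surjInv E.rightHom_surjective q

@[simp]
theorem rightHom_sec (q : Q) : E.rightHom (E.sec q) = q :=
  Function.surjInv_eq E.rightHom_surjective q

@[simp]
theorem rightHom_inl (n : N) : E.rightHom (E.inl n) = 1 := by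
  rw [← MonoidHom.mem_ker, ← E.range_inl_eq_ker_rightHom]
  exact ⟨n, rfl⟩

theorem exists_inl_of_rightHom_eq_one {g : G} (hg : E.rightHom g = 1) : ∃ n, E.inl n = g := by
  rwa [← MonoidHom.mem_ker, ← E.range_inl_eq_ker_rightHom] at hg

theorem exists_eq_sec_mul_inl (g : G) : ∃ n, g = E.sec (E.rightHom g) * E.inl n := by
  obtain ⟨n, hn⟩ := E.exists_inl_of_rightHom_eq_one (g := (E.sec (E.rightHom g))⁻¹ * g) (by simp)
  exact ⟨n, by simp [hn]⟩

theorem exists_mul_eq_inl_mul (g h : G) : ∃ n, g * h = E.inl n * (h * g) := by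
  obtain ⟨n, hn⟩ := E.exists_inl_of_rightHom_eq_one (g := g * h * (h * g)⁻¹)
    (by rw [map_mul, map_inv, map_mul, map_mul, mul_comm (E.rightHom h), mul_inv_cancel])
  exact ⟨n, by rw [hn, inv_mul_cancel_right]⟩

theorem inl_comm (n : N) (g : G) : g * E.inl n = E.inl n * g :=
  Subgroup.mem_center_iff.1 (E.inl_range_le_center ⟨n, rfl⟩) g

@[simp]
theorem incl_single (n : N) (a : k) :
    E.incl k (MonoidAlgebra.single n a) = MonoidAlgebra.single (E.inl n) a := by
  simp [incl]

theorem single_eq_sec_mul_incl (g : G) : ∃ n, (MonoidAlgebra.single g 1 : MonoidAlgebra k G) =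
    MonoidAlgebra.single (E.sec (E.rightHom g)) 1 * E.incl k (MonoidAlgebra.single n 1) := by
  obtain ⟨n, hn⟩ := E.exists_eq_sec_mul_inl g
  refine ⟨n, ?_⟩
  rw [incl_single, MonoidAlgebra.single_mul_single, ← hn, one_mul]

/-- If `N` becomes scalar under a homomorphism, then its image is spanned by the image of a set of
coset representatives. -/
theorem map_mem_span_sec {B : Type*} [Ring B] [Algebra k B] (f : MonoidAlgebra k G →ₐ[k] B)
    (hf : ∀ n, ∃ c : k, f (MonoidAlgebra.single (E.inl n) 1) = algebraMap k B c)
    (h : MonoidAlgebra k G) :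
    f h ∈ Submodule.span k (Set.range fun q => f (MonoidAlgebra.single (E.sec q) 1)) := by
  induction h using MonoidAlgebra.induction_on with
  | of g =>
    obtain ⟨n, hn⟩ := E.single_eq_sec_mul_incl (k := k) g
    obtain ⟨c, hc⟩ := hf n
    rw [MonoidAlgebra.of_apply, hn, map_mul, incl_single, hc, ← Algebra.commutes,
      ← Algebra.smul_def]
    exact Submodule.smul_mem _ _ (Submodule.subset_span ⟨_, rfl⟩)
  | add x y hx hy => rw [map_add]; exact add_mem hx hy
  | smul r x hx => rw [map_smul]; exact Submodule.smul_mem _ _ hx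

section Module

variable (V : Type*) [AddCommGroup V] [Module k V] [Module (MonoidAlgebra k G) V]
  [IsScalarTower k (MonoidAlgebra k G) V]

/-- The subgroup `N` acts on `V` by scalars. -/
def ActsByScalars : Prop :=
  ∀ n, ∃ c : k, ∀ v : V, (MonoidAlgebra.single (E.inl n) 1 : MonoidAlgebra k G) • v = c • v

variable {V} {E}

theorem ActsByScalars.lsmul (hV : E.ActsByScalars (k := k) V) (n : N) :
    ∃ c : k, (Algebra.lsmul k k V : MonoidAlgebra k G →ₐ[k] _) (MonoidAlgebra.single (E.inl n) 1) =
      algebraMap k (Module.End k V) c := by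
  obtain ⟨c, hc⟩ := hV n
  exact ⟨c, LinearMap.ext hc⟩

theorem ActsByScalars.finiteDimensional [Finite Q] [IsSimpleModule (MonoidAlgebra k G) V]
    (hV : E.ActsByScalars (k := k) V) : FiniteDimensional k V := by
  have := IsSimpleModule.nontrivial (MonoidAlgebra k G) V
  obtain ⟨v, hv⟩ := exists_ne (0 : V)
  let S := Submodule.span k (Set.range fun q =>
    (Algebra.lsmul k k V : MonoidAlgebra k G →ₐ[k] _) (MonoidAlgebra.single (E.sec q) 1))
  have : FiniteDimensional k S := FiniteDimensional.span_of_finite k (Set.finite_range _)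
  refine Module.Finite.of_surjective ((LinearMap.applyₗ v).domRestrict S) fun w => ?_
  obtain ⟨h, rfl⟩ := IsSimpleModule.toSpanSingleton_surjective (MonoidAlgebra k G) hv w
  exact ⟨⟨_, E.map_mem_span_sec _ hV.lsmul h⟩, rfl⟩

variable (E V)

/-- `V` is not yet known to be finite-dimensional, so eigenvalues are unavailable. Instead, `V` is
finite over `C` and so has a maximal `C`-submodule `W`, with `V/W ≅ C/I`. Then `IV ⊆ W` is proper
and, `C` being central, `H`-stable; simplicity forces `IV = 0`, and `C/I = k`. -/
theorem actsByScalars_of_isSimpleModule [IsAlgClosed k] [Group.FG N] [Finite Q]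
    [IsSimpleModule (MonoidAlgebra k G) V] : E.ActsByScalars (k := k) V := by
  have := IsSimpleModule.nontrivial (MonoidAlgebra k G) V
  let _ : Module (MonoidAlgebra k N) V := Module.compHom V (E.incl k).toRingHom
  have hsm : ∀ (c : MonoidAlgebra k N) (v : V), c • v = E.incl k c • v := fun _ _ => rfl
  have hcomm : ∀ (c : MonoidAlgebra k N) (h : MonoidAlgebra k G) (v : V),
      h • (c • v) = c • (h • v) := by
    intro c h v
    rw [hsm, hsm, smul_smul, smul_smul, E.incl_comm]
  have hfin : Module.Finite (MonoidAlgebra k N) V := by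
    obtain ⟨v, hv⟩ := exists_ne (0 : V)
    refine ⟨Submodule.fg_def.2 ⟨Set.range fun q =>
      (MonoidAlgebra.single (E.sec q) 1 : MonoidAlgebra k G) • v, Set.finite_range _, ?_⟩⟩
    rw [eq_top_iff]
    rintro w -
    obtain ⟨h, rfl⟩ := IsSimpleModule.toSpanSingleton_surjective (MonoidAlgebra k G) hv w
    rw [LinearMap.toSpanSingleton_apply]
    induction h using MonoidAlgebra.induction_on with
    | of g =>
      obtain ⟨n, hn⟩ := E.single_eq_sec_mul_incl (k := k) g
      rw [MonoidAlgebra.of_apply, hn, mul_smul, ← hsm, hcomm]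
      exact Submodule.smul_mem _ _ (Submodule.subset_span ⟨_, rfl⟩)
    | add x y hx hy => rw [add_smul]; exact add_mem hx hy
    | smul r x hx =>
      have h1 : (r • x) • v = (algebraMap k (MonoidAlgebra k N) r) • (x • v) := by
        rw [hsm, AlgHom.commutes, smul_smul, Algebra.smul_def]
      rw [h1]
      exact Submodule.smul_mem _ _ hx
  obtain ⟨W, hW, -⟩ := (eq_top_or_exists_le_coatom
    (⊥ : Submodule (MonoidAlgebra k N) V)).resolve_left bot_ne_top
  have := isSimpleModule_iff_isCoatom.2 hW
  obtain ⟨I, hI, ⟨e⟩⟩ := isSimpleModule_iff_quot_maximal.1 this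
  have hIW : ∀ c ∈ I, ∀ v : V, c • v ∈ W := by
    intro c hc v
    rw [← Submodule.Quotient.mk_eq_zero, ← e.map_eq_zero_iff, Submodule.Quotient.mk_smul, map_smul]
    obtain ⟨d, hd⟩ := Ideal.Quotient.mk_surjective (e (Submodule.Quotient.mk v))
    rw [← hd]
    change Ideal.Quotient.mk I (c * d) = 0
    exact Ideal.Quotient.eq_zero_iff_mem.2 (I.mul_mem_right _ hc)
  let U : Submodule (MonoidAlgebra k G) V :=
    Submodule.span _ {x | ∃ c ∈ I, ∃ v : V, x = c • v}
  have hUW : ∀ x ∈ U, ∀ h : MonoidAlgebra k G, h • x ∈ W := by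
    intro x hx
    induction hx using Submodule.span_induction with
    | mem x hx =>
      obtain ⟨c, hc, v, rfl⟩ := hx
      intro h
      rw [hcomm]
      exact hIW c hc _
    | zero => intro h; rw [smul_zero]; exact zero_mem _
    | add x y _ _ hx hy => intro h; rw [smul_add]; exact add_mem (hx h) (hy h)
    | smul a x _ hx => intro h; rw [smul_smul]; exact hx _
  have hU : U = ⊥ := by
    refine (eq_bot_or_eq_top U).resolve_right fun hU => hW.1 ?_
    rw [eq_top_iff]
    intro x _
    simpa using hUW x (hU ▸ Submodule.mem_top) 1
  intro n
  obtain ⟨a, ha⟩ := exists_sub_algebraMap_mem_of_isMaximal (k := k) I (MonoidAlgebra.single n 1)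
  refine ⟨a, fun v => ?_⟩
  have h0 : (MonoidAlgebra.single n 1 - algebraMap k (MonoidAlgebra k N) a) • v = 0 := by
    rw [← Submodule.mem_bot (MonoidAlgebra k G), ← hU]
    exact Submodule.subset_span ⟨_, ha, v, rfl⟩
  rwa [hsm, map_sub, AlgHom.commutes, sub_smul, sub_eq_zero, incl_single, algebraMap_smul] at h0

end Module

end CentralExtension

/-! ### Stabilizers and maximal stability. -/

theorem tensorRep_single_tmul {k G V : Type*} [Field k] [Group G] [AddCommGroup V] [Module k V]
    [Module (MonoidAlgebra k G) V] [IsScalarTower k (MonoidAlgebra k G) V]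
    (χ : MonoidAlgebra k G →ₐ[k] k) (g : G) (a : k) (v : V) :
    tensorRep ((Algebra.lmul k k).comp χ) (Algebra.lsmul k k V) (MonoidAlgebra.single g 1)
      (a ⊗ₜ[k] v) = (χ (MonoidAlgebra.single g 1) * a) ⊗ₜ[k]
        ((MonoidAlgebra.single g 1 : MonoidAlgebra k G) • v) := by
  simp only [tensorRep, AlgHom.comp_apply, Bialgebra.comulAlgHom_apply,
    MonoidAlgebra.comul_single, CommSemiring.comul_apply, TensorProduct.map_tmul,
    Algebra.TensorProduct.map_tmul, MonoidAlgebra.lsingle_apply]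
  rfl

theorem MonoidAlgebra.single_smul_ne_zero {k G V : Type*} [Field k] [Group G] [AddCommGroup V]
    [Module (MonoidAlgebra k G) V] (g : G) {v : V} (hv : v ≠ 0) :
    (MonoidAlgebra.single g 1 : MonoidAlgebra k G) • v ≠ 0 := by
  intro h
  have := congr((MonoidAlgebra.single g⁻¹ 1 : MonoidAlgebra k G) • $h)
  rw [smul_smul, MonoidAlgebra.single_mul_single, inv_mul_cancel, one_mul, ← MonoidAlgebra.one_def,
    one_smul, smul_zero] at this
  exact hv this

namespace CentralExtension

variable {k N G Q : Type*} [Field k] [CommGroup N] [Group G] [CommGroup Q]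
  (E : CentralExtension N G Q)

section Stab

variable (V : Type*) [AddCommGroup V] [Module k V] [Module (MonoidAlgebra k G) V]
  [IsScalarTower k (MonoidAlgebra k G) V]

/-- Identifying `k ⊗ V` with `V` turns an isomorphism into an operator `T` with `g T g⁻¹ = χ(g) T`,
a condition that need only be tested on group elements. -/
theorem mem_stab_iff (χ : MonoidAlgebra k G →ₐ[k] k) :
    χ ∈ E.stab k V ↔ χ ∈ E.identityChars k ∧ ∃ T : V ≃ₗ[k] V, ∀ (g : G) (v : V),
      χ (MonoidAlgebra.single g 1) • T ((MonoidAlgebra.single g 1 : MonoidAlgebra k G) • v) =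
        (MonoidAlgebra.single g 1 : MonoidAlgebra k G) • T v := by
  refine and_congr_right fun _ => ⟨fun ⟨f, hf⟩ => ?_, fun ⟨T, hT⟩ => ?_⟩
  · refine ⟨(TensorProduct.lid k V).symm ≪≫ₗ f, fun g v => ?_⟩
    simp only [LinearEquiv.trans_apply, TensorProduct.lid_symm_apply]
    rw [← hf, tensorRep_single_tmul, ← map_smul, TensorProduct.smul_tmul', smul_eq_mul]
  · refine ⟨TensorProduct.lid k V ≪≫ₗ T, fun h t => ?_⟩
    induction h using MonoidAlgebra.induction_on with
    | of g =>
      induction t using TensorProduct.induction_on with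
      | zero => simp
      | tmul a v =>
        rw [MonoidAlgebra.of_apply, tensorRep_single_tmul]
        simp only [LinearEquiv.trans_apply, TensorProduct.lid_tmul, map_smul, mul_smul]
        rw [smul_comm, hT, smul_comm]
      | add x y hx hy => rw [map_add, map_add, hx, hy, map_add, smul_add]
    | add x y hx hy => rw [map_add, LinearMap.add_apply, map_add, hx, hy, add_smul]
    | smul r x hx => rw [map_smul, LinearMap.smul_apply, map_smul, hx, smul_assoc]

variable {V} in
/-- The scalars by which `G` commutes past a fixed `g` form a character. -/
theorem exists_commutator_char [Nontrivial V] (hV : E.ActsByScalars (k := k) V) (g : G) :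
    ∃ χ : MonoidAlgebra k G →ₐ[k] k, ∀ (h : G) (v : V),
      χ (MonoidAlgebra.single h 1) • (MonoidAlgebra.single g 1 : MonoidAlgebra k G) •
          (MonoidAlgebra.single h 1 : MonoidAlgebra k G) • v =
        (MonoidAlgebra.single h 1 : MonoidAlgebra k G) •
          (MonoidAlgebra.single g 1 : MonoidAlgebra k G) • v := by
  have hex : ∀ h : G, ∃ b : k, ∀ v : V,
      b • (MonoidAlgebra.single g 1 : MonoidAlgebra k G) •
          (MonoidAlgebra.single h 1 : MonoidAlgebra k G) • v =
        (MonoidAlgebra.single h 1 : MonoidAlgebra k G) •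
          (MonoidAlgebra.single g 1 : MonoidAlgebra k G) • v := by
    intro h
    -- `Q` is abelian, so the commutator of `h` and `g` lies in `N` and acts by a scalar.
    obtain ⟨n, hn⟩ := E.exists_mul_eq_inl_mul h g
    obtain ⟨c, hc⟩ := hV n
    refine ⟨c, fun v => ?_⟩
    rw [← hc, smul_smul, smul_smul, smul_smul]
    simp only [MonoidAlgebra.single_mul_single, one_mul, hn, mul_assoc]
  choose b hb using hex
  obtain ⟨v, hv⟩ := exists_ne (0 : V)
  -- Group elements act invertibly, so the scalar is determined by its effect on one nonzero vector;
  -- multiplicativity follows from this uniqueness.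
  have huniq : ∀ (h : G) (c d : k), c • (MonoidAlgebra.single g 1 : MonoidAlgebra k G) •
      (MonoidAlgebra.single h 1 : MonoidAlgebra k G) • v =
      d • (MonoidAlgebra.single g 1 : MonoidAlgebra k G) •
      (MonoidAlgebra.single h 1 : MonoidAlgebra k G) • v → c = d := fun h c d hcd =>
    smul_left_injective k (MonoidAlgebra.single_smul_ne_zero g (MonoidAlgebra.single_smul_ne_zero h hv)) hcd
  refine ⟨MonoidAlgebra.lift k k G
    { toFun := b
      map_one' := huniq 1 _ _ ?_
      map_mul' := fun h h' => huniq (h * h') _ _ ?_ }, fun h v => ?_⟩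
  · rw [hb, ← MonoidAlgebra.one_def]
    simp
  · have hm : (MonoidAlgebra.single (h * h') 1 : MonoidAlgebra k G) =
        MonoidAlgebra.single h 1 * MonoidAlgebra.single h' 1 := by simp
    rw [hb, hm, mul_smul, mul_smul, mul_smul, ← hb h', smul_comm _ (b h'), ← hb h, smul_smul,
      mul_comm, mul_smul (b h)]
  · simpa using hb h v

theorem maximallyStable_of_isSimpleModule [IsAlgClosed k] [FiniteDimensional k V]
    [IsSimpleModule (MonoidAlgebra k G) V] (hV : E.ActsByScalars (k := k) V) :
    E.MaximallyStable k V := by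
  have := IsSimpleModule.nontrivial (MonoidAlgebra k G) V
  have hT : ∀ χ : E.stab k V, ∃ T : V ≃ₗ[k] V, ∀ (g : G) (v : V),
      (χ : MonoidAlgebra k G →ₐ[k] k) (MonoidAlgebra.single g 1) •
          T ((MonoidAlgebra.single g 1 : MonoidAlgebra k G) • v) =
        (MonoidAlgebra.single g 1 : MonoidAlgebra k G) • T v :=
    fun χ => ((E.mem_stab_iff V χ.1).1 χ.2).2
  choose T hT using hT
  let b : E.stab k V → Module.End k V := fun χ => (T χ).toLinearMap
  have hli : LinearIndependent k b := by
    let ev : E.stab k V → (G →* k) := fun χ => (MonoidAlgebra.lift k k G).symm χ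
    have hev : Function.Injective ev :=
      (MonoidAlgebra.lift k k G).symm.injective.comp Subtype.val_injective
    have hch := (linearIndependent_monoidHom G k).comp ev hev
    rw [linearIndependent_iff'] at hch ⊢
    intro s c hc χ hχ
    obtain ⟨v, hv⟩ := exists_ne (0 : V)
    have hz : c χ • T χ v = 0 := by
      rw [← Module.forall_dual_apply_eq_zero_iff k]
      intro φ
      rw [map_smul, smul_eq_mul]
      refine hch s (fun χ => c χ * φ (T χ v)) ?_ χ hχ
      ext g
      -- Conjugating the relation by `g` multiplies the term of `χ` by `χ(g)`, which gives a linear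
      -- relation between distinct characters of `G`.
      have h1 := congr(φ ((MonoidAlgebra.single g 1 : MonoidAlgebra k G) • ($hc
        ((MonoidAlgebra.single g⁻¹ 1 : MonoidAlgebra k G) • v))))
      simp only [LinearMap.sum_apply, LinearMap.smul_apply, Finset.smul_sum, b,
        LinearEquiv.coe_coe, LinearMap.zero_apply, smul_zero, map_zero, map_sum] at h1
      refine Eq.trans ?_ h1
      rw [Finset.sum_apply]
      refine Finset.sum_congr rfl fun χ _ => ?_
      rw [smul_comm, ← hT, smul_smul (MonoidAlgebra.single g 1 : MonoidAlgebra k G),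
        MonoidAlgebra.single_mul_single, mul_inv_cancel, one_mul, ← MonoidAlgebra.one_def, one_smul]
      simp [ev]
      ring
    exact (smul_eq_zero.1 hz).resolve_right ((T χ).map_ne_zero_iff.2 hv)
  have hsp : ⊤ ≤ Submodule.span k (Set.range b) := by
    have key : ∀ g : G, (Algebra.lsmul k k V : MonoidAlgebra k G →ₐ[k] _)
        (MonoidAlgebra.single g 1) ∈ Submodule.span k (Set.range b) := by
      intro g
      obtain ⟨χ, hχ⟩ := E.exists_commutator_char hV g
      have hu : IsUnit ((Algebra.lsmul k k V : MonoidAlgebra k G →ₐ[k] _)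
          (MonoidAlgebra.single g 1)) := by
        refine IsUnit.map _ ⟨⟨MonoidAlgebra.single g 1, MonoidAlgebra.single g⁻¹ 1, ?_, ?_⟩, rfl⟩ <;>
        simp [MonoidAlgebra.one_def]
      let R : V ≃ₗ[k] V := LinearMap.GeneralLinearGroup.toLinearEquiv hu.unit
      have hR : ∀ v, R v = (MonoidAlgebra.single g 1 : MonoidAlgebra k G) • v := fun _ => rfl
      have hstab : χ ∈ E.stab k V := by
        refine (E.mem_stab_iff V χ).2 ⟨?_, R, fun h v => ?_⟩
        · have hc : χ.comp (E.incl k) = Bialgebra.counitAlgHom k (MonoidAlgebra k N) := by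
            refine MonoidAlgebra.algHom_ext (fun n => ?_) (Subsingleton.elim _ _)
            obtain ⟨v, hv⟩ := exists_ne (0 : V)
            have h1 := hχ (E.inl n) v
            rw [smul_smul (MonoidAlgebra.single g 1 : MonoidAlgebra k G),
              smul_smul (MonoidAlgebra.single (E.inl n) 1 : MonoidAlgebra k G),
              MonoidAlgebra.single_mul_single, MonoidAlgebra.single_mul_single, E.inl_comm] at h1
            have h2 := smul_left_injective k
              (MonoidAlgebra.single_smul_ne_zero (k := k) (E.inl n * g) hv) (a₂ := 1)
              (by simpa using h1)
            simpa using h2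
          intro c hc'
          exact (DFunLike.congr_fun hc c).trans hc'
        · rw [hR, hR, hχ]
      -- `R` and `T` are twisted by the same `χ`, so `T⁻¹R` commutes with `H`; by Schur it is a
      -- scalar and `R` is a multiple of `T`.
      let a : Module.End (MonoidAlgebra k G) V :=
        { toFun := fun v => (T ⟨χ, hstab⟩).symm (R v)
          map_add' := fun v w => by simp
          map_smul' := fun h v => by
            induction h using MonoidAlgebra.induction_on with
            | of h =>
              have h0 : χ (MonoidAlgebra.single h 1) ≠ 0 := by
                intro h0
                have := Winding.char_mul_inv χ h
                rw [h0, zero_mul] at this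
                exact zero_ne_one this
              rw [MonoidAlgebra.of_apply, LinearEquiv.symm_apply_eq, RingHom.id_apply]
              apply smul_right_injective V h0
              change χ _ • _ = χ _ • _
              rw [hR, hχ, hT ⟨χ, hstab⟩, LinearEquiv.apply_symm_apply, hR]
            | add x y hx hy => simp only [add_smul, map_add, hx, hy, RingHom.id_apply] at *
            | smul r x hx =>
              simp only [smul_assoc, map_smul, RingHom.id_apply] at *
              rw [hx] }
      obtain ⟨c, hc⟩ := (IsSimpleModule.algebraMap_end_bijective_of_isAlgClosed
        (A := MonoidAlgebra k G) (V := V) k).2 a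
      have : (Algebra.lsmul k k V : MonoidAlgebra k G →ₐ[k] _) (MonoidAlgebra.single g 1) =
          c • b ⟨χ, hstab⟩ := by
        ext v
        have h1 := congr(T ⟨χ, hstab⟩ ($hc v))
        change T ⟨χ, hstab⟩ (c • v) = T ⟨χ, hstab⟩ ((T ⟨χ, hstab⟩).symm (R v)) at h1
        rw [LinearEquiv.apply_symm_apply, map_smul] at h1
        exact h1.symm
      rw [this]
      exact Submodule.smul_mem _ _ (Submodule.subset_span ⟨_, rfl⟩)
    rintro f -
    obtain ⟨h, rfl⟩ := lsmul_surjective_of_isSimpleModule (k := k) (H := MonoidAlgebra k G) f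
    induction h using MonoidAlgebra.induction_on with
    | of g => exact key g
    | add x y hx hy => rw [map_add]; exact add_mem hx hy
    | smul r x hx => rw [map_smul]; exact Submodule.smul_mem _ _ hx
  let B := Module.Basis.mk hli hsp
  have hfin : Finite (E.stab k V) := Module.Finite.finite_basis B
  refine ⟨inferInstance, Set.toFinite _, ?_⟩
  rw [← Nat.card_coe_set_eq, ← Module.finrank_eq_nat_card_basis B, Module.finrank_linearMap, sq]

end Stab

end CentralExtension

/-! ### Fiber algebras. -/

namespace CentralExtension

variable {k N G Q : Type*} [Field k] [CommGroup N] [Group G] [CommGroup Q]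
  (E : CentralExtension N G Q)

section Fiber

variable {m : Ideal (MonoidAlgebra k N)} (V : Type*) [AddCommGroup V] [Module k V]
  [Module (E.Fiber m) V] [IsScalarTower k (E.Fiber m) V]

/-- The twist by a character of `Q` of the action of a fiber algebra. -/
noncomputable def twist (η : Q →* kˣ) : E.Fiber m →ₐ[k] Module.End k V :=
  Ideal.Quotient.liftₐ (E.fiberIdeal m)
    (MonoidAlgebra.lift k (Module.End k V) G
      { toFun := fun g => (η (E.rightHom g) : k) •
          Algebra.lsmul k k V (Ideal.Quotient.mk (E.fiberIdeal m) (MonoidAlgebra.single g 1))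
        map_one' := by simp [← MonoidAlgebra.one_def]
        map_mul' := fun g h => by
          rw [← one_mul (1 : k), ← MonoidAlgebra.single_mul_single, one_mul]
          simp only [map_mul, Units.val_mul, smul_mul_smul_comm] })
    (by
      set φ := MonoidAlgebra.lift k (Module.End k V) G _ with hφ
      -- A character of `Q` is trivial on `N`, so twisting leaves the action of `C` unchanged and
      -- `m` still acts by zero.
      have key : φ.comp (E.incl k) = ((Algebra.lsmul k k V).comp
          (Ideal.Quotient.mkₐ k (E.fiberIdeal m))).comp (E.incl k) := by
        refine MonoidAlgebra.algHom_ext (fun n => ?_) (Subsingleton.elim _ _)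
        simp [hφ]
      suffices h : E.fiberIdeal m ≤ RingHom.ker φ from fun a ha => h ha
      refine Ideal.map_le_iff_le_comap.2 fun c hc => ?_
      refine (DFunLike.congr_fun key c).trans ?_
      have h0 : Ideal.Quotient.mk (E.fiberIdeal m) (E.incl k c) = 0 :=
        Ideal.Quotient.eq_zero_iff_mem.2 (Ideal.mem_map_of_mem _ hc)
      simp [h0])

theorem twist_single (η : Q →* kˣ) (g : G) (v : V) :
    E.twist V η (Ideal.Quotient.mk (E.fiberIdeal m) (MonoidAlgebra.single g 1)) v =
      (η (E.rightHom g) : k) •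
        (Ideal.Quotient.mk (E.fiberIdeal m) (MonoidAlgebra.single g 1)) • v := by
  change MonoidAlgebra.lift k (Module.End k V) G _ (MonoidAlgebra.single g 1) v = _
  simp

theorem exists_mk_single_inl_eq [IsAlgClosed k] [Group.FG N] [m.IsMaximal] (n : N) :
    ∃ c : k, Ideal.Quotient.mkₐ k (E.fiberIdeal m) (MonoidAlgebra.single (E.inl n) 1) =
      algebraMap k (E.Fiber m) c := by
  obtain ⟨a, ha⟩ := exists_sub_algebraMap_mem_of_isMaximal (k := k) m (MonoidAlgebra.single n 1)
  refine ⟨a, ?_⟩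
  have h : Ideal.Quotient.mkₐ k (E.fiberIdeal m)
      (E.incl k (MonoidAlgebra.single n 1 - algebraMap k _ a)) = 0 :=
    Ideal.Quotient.eq_zero_iff_mem.2 (Ideal.mem_map_of_mem (E.incl k) ha)
  rw [map_sub, map_sub, sub_eq_zero, incl_single, AlgHom.commutes] at h
  exact h

theorem span_sec_eq_top [IsAlgClosed k] [Group.FG N] [m.IsMaximal] :
    ⊤ ≤ Submodule.span k (Set.range fun q =>
      Ideal.Quotient.mkₐ k (E.fiberIdeal m) (MonoidAlgebra.single (E.sec q) 1)) := by
  rintro x -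
  obtain ⟨h, rfl⟩ := Ideal.Quotient.mkₐ_surjective k (E.fiberIdeal m) x
  exact E.map_mem_span_sec _ E.exists_mk_single_inl_eq h

/-- Applied to a vector `v ≠ 0`, the twists give `∑ η(q) c_q (sec q) v = 0` for all `η`. Character
separation isolates each term, and `sec q` acts invertibly. This serves twice: for independence of
the coset representatives and for joint injectivity of the twists. -/
theorem coeff_smul_eq_zero_of_twist_eq_zero [IsAlgClosed k] [Fintype Q]
    (hQ : (Nat.card Q : k) ≠ 0) (c : Q → k)
    (hc : ∀ η : Q →* kˣ, E.twist (m := m) V η (∑ q, c q •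
      Ideal.Quotient.mkₐ k (E.fiberIdeal m) (MonoidAlgebra.single (E.sec q) 1)) = 0) [Nontrivial V] :
    c = 0 := by
  obtain ⟨v, hv⟩ := exists_ne (0 : V)
  let _ : Module (MonoidAlgebra k G) V := Module.compHom V (Ideal.Quotient.mk (E.fiberIdeal m))
  funext q
  have := eq_zero_of_forall_sum_char_smul hQ (fun q => c q •
    Ideal.Quotient.mk (E.fiberIdeal m) (MonoidAlgebra.single (E.sec q) 1) • v) (fun η => by
      have h := congr($(hc η) v)
      simp only [map_sum, map_smul, LinearMap.sum_apply, LinearMap.smul_apply,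
        Ideal.Quotient.mkₐ_eq_mk, twist_single, rightHom_sec, LinearMap.zero_apply] at h
      rw [← h]
      exact Finset.sum_congr rfl fun q _ => smul_comm _ _ _) q
  exact (smul_eq_zero.1 this).resolve_right fun h =>
    MonoidAlgebra.single_smul_ne_zero (k := k) (E.sec q) hv h

theorem exists_fiber_algEquiv [IsAlgClosed k] [Group.FG N] [Finite Q] [m.IsMaximal]
    (hQ : (Nat.card Q : k) ≠ 0) [IsSimpleModule (E.Fiber m) V] :
    FiniteDimensional k V ∧
        ∃ r : ℕ, r * Module.finrank k V ^ 2 = Nat.card Q ∧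
          Nonempty (E.Fiber m ≃ₐ[k]
            (Fin r → Matrix (Fin (Module.finrank k V)) (Fin (Module.finrank k V)) k)) := by
  have := Fintype.ofFinite Q
  have := IsSimpleModule.nontrivial (E.Fiber m) V
  have hF : FiniteDimensional k (E.Fiber m) :=
    ⟨Submodule.fg_def.2 ⟨_, Set.finite_range _, top_le_iff.1 E.span_sec_eq_top⟩⟩
  have hV : FiniteDimensional k V := by
    obtain ⟨v, hv⟩ := exists_ne (0 : V)
    exact Module.Finite.of_surjective
      ((LinearMap.toSpanSingleton (E.Fiber m) V v).restrictScalars k)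
      (IsSimpleModule.toSpanSingleton_surjective _ hv)
  refine ⟨hV, ?_⟩
  have hli : LinearIndependent k (fun q =>
      Ideal.Quotient.mkₐ k (E.fiberIdeal m) (MonoidAlgebra.single (E.sec q) 1)) := by
    rw [Fintype.linearIndependent_iff]
    intro c hc
    exact congrFun (E.coeff_smul_eq_zero_of_twist_eq_zero V hQ c (fun η => by rw [hc, map_zero]))
  let B := Module.Basis.mk hli E.span_sec_eq_top
  have : NeZero (Module.finrank k V) := ⟨Module.finrank_pos.ne'⟩
  -- A twist only rescales the operators of group elements by units, so its image is still all of
  -- `End V`.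
  have hsurj : ∀ η : Q →* kˣ, Function.Surjective (E.twist (m := m) V η) := by
    intro η f
    obtain ⟨x, rfl⟩ := lsmul_surjective_of_isSimpleModule (k := k) (H := E.Fiber m) f
    obtain ⟨h, rfl⟩ := Ideal.Quotient.mk_surjective x
    rw [← AlgHom.mem_range]
    induction h using MonoidAlgebra.induction_on with
    | of g =>
      refine ⟨((η (E.rightHom g))⁻¹ : kˣ) • Ideal.Quotient.mk (E.fiberIdeal m)
        (MonoidAlgebra.single g 1), ?_⟩
      ext v
      change E.twist V η ((((η (E.rightHom g))⁻¹ : kˣ) : k) • _) v = _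
      rw [map_smul, LinearMap.smul_apply, twist_single, smul_smul, Units.inv_mul, one_smul]
      rfl
    | add x y hx hy => rw [map_add, map_add]; exact add_mem hx hy
    | smul r x hx =>
      rw [← Ideal.Quotient.mkₐ_eq_mk k, map_smul, map_smul]
      exact Subalgebra.smul_mem _ hx r
  obtain ⟨r, hr, he⟩ := exists_algEquiv_pi_matrix_of_separating
    (fun η : Q →* kˣ => ((algEquivMatrix (Module.finBasis k V)).toAlgHom.comp
      (E.twist (m := m) V η)))
    (fun η => (algEquivMatrix (Module.finBasis k V)).surjective.comp (hsurj η))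
    (fun x hx => by
      have hx' : ∀ η : Q →* kˣ, E.twist (m := m) V η x = 0 := fun η =>
        (algEquivMatrix (Module.finBasis k V)).injective ((hx η).trans (map_zero _).symm)
      rw [← B.sum_repr x] at hx' ⊢
      simp only [B, Module.Basis.mk_apply] at hx' ⊢
      have := E.coeff_smul_eq_zero_of_twist_eq_zero V hQ _ hx'
      refine Finset.sum_eq_zero fun q _ => ?_
      rw [congrFun this q, Pi.zero_apply, zero_smul])
  refine ⟨r, ?_, he⟩
  rw [hr, Module.finrank_eq_card_basis B, Nat.card_eq_fintype_card]

end Fiber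

end CentralExtension

/-! ### The orbit of the augmentation ideal. -/

namespace CentralExtension

variable {k N G Q : Type*} [Field k] [CommGroup N] [Group G] [CommGroup Q]
  (E : CentralExtension N G Q)

/-- The preimage in `N` of the commutator subgroup of `G`. -/
def commutatorComap : Subgroup N := (commutator G).comap E.inl

theorem commutator_le_map_commutatorComap : commutator G ≤ E.commutatorComap.map E.inl := by
  intro g hg
  have : g ∈ E.rightHom.ker := Abelianization.commutator_subset_ker E.rightHom hg
  obtain ⟨n, rfl⟩ := E.exists_inl_of_rightHom_eq_one this
  exact ⟨n, hg, rfl⟩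

theorem quotient_commutatorComap_mul_comm (x y : G ⧸ E.commutatorComap.map E.inl) :
    x * y = y * x := by
  have h := (Subgroup.Normal.quotient_commutative_iff_commutator_le
    (N := E.commutatorComap.map E.inl)).2 E.commutator_le_map_commutatorComap
  exact h.is_comm.comm x y

theorem exists_extend_algHom [IsAlgClosed k]
    (ψ : MonoidAlgebra k (N ⧸ E.commutatorComap) →ₐ[k] k) :
    ∃ χ : MonoidAlgebra k G →ₐ[k] k, χ.comp (E.incl k) =
      ψ.comp (MonoidAlgebra.mapDomainAlgHom k k (QuotientGroup.mk' E.commutatorComap)) := by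
  let i : N ⧸ E.commutatorComap →* Abelianization G :=
    QuotientGroup.lift _ (Abelianization.of.comp E.inl) fun n hn =>
      (QuotientGroup.eq_one_iff _).2 hn
  have hi : Function.Injective i := by
    rw [injective_iff_map_eq_one]
    intro x hx
    obtain ⟨n, rfl⟩ := QuotientGroup.mk_surjective x
    -- Injectivity holds because `A` is the full preimage of the commutator subgroup.
    exact (QuotientGroup.eq_one_iff _).2 ((QuotientGroup.eq_one_iff (E.inl n)).1 hx)
  obtain ⟨χ, hχ⟩ := exists_extend_char i hi ((MonoidAlgebra.lift k k _).symm ψ).toHomUnits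
  refine ⟨MonoidAlgebra.lift k k G ((Units.coeHom k).comp (χ.comp Abelianization.of)), ?_⟩
  refine MonoidAlgebra.algHom_ext (fun n => ?_) (Subsingleton.elim _ _)
  have h : (χ (Abelianization.of (E.inl n)) : k) =
      ψ (MonoidAlgebra.single (n : N ⧸ E.commutatorComap) 1) :=
    congr((($hχ (QuotientGroup.mk n) : kˣ) : k))
  simpa using h

/-- A character has commutative target, so it kills `[G, G]` and its restriction to `N` kills `A`.
-/
theorem exists_descend_algHom (χ : MonoidAlgebra k G →ₐ[k] k) :
    ∃ ψ : MonoidAlgebra k (N ⧸ E.commutatorComap) →ₐ[k] k,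
      ψ.comp (MonoidAlgebra.mapDomainAlgHom k k (QuotientGroup.mk' E.commutatorComap)) =
        χ.comp (E.incl k) := by
  let χ' : G →* kˣ := ((MonoidAlgebra.lift k k G).symm χ).toHomUnits
  let μ : N ⧸ E.commutatorComap →* kˣ := QuotientGroup.lift _ (χ'.comp E.inl) fun n hn =>
    Abelianization.commutator_subset_ker χ' hn
  refine ⟨MonoidAlgebra.lift k k _ ((Units.coeHom k).comp μ), ?_⟩
  refine MonoidAlgebra.algHom_ext (fun n => ?_) (Subsingleton.elim _ _)
  have h : (μ n : k) = χ (MonoidAlgebra.single (E.inl n) 1) := rfl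
  simpa using h

theorem incl_injective : Function.Injective (E.incl k) :=
  MonoidAlgebra.mapDomain_injective E.inl_injective

/-- The group algebra is cocommutative: both automorphisms send `g` to `χ(g) g`. -/
theorem leftAut_eq_rightAut : (Winding.leftAut : (MonoidAlgebra k G →ₐ[k] k) → _) =
    Winding.rightAut := by
  funext χ
  refine AlgEquiv.coe_toAlgHom_injective ?_
  refine MonoidAlgebra.algHom_ext (fun g => ?_) (Subsingleton.elim _ _)
  change Winding.leftHom χ _ = Winding.rightHom χ _
  rw [Winding.leftHom_single, Winding.rightHom_single]

theorem leftAut_comp_incl_mem_range (χ : MonoidAlgebra k G →ₐ[k] k) (c : MonoidAlgebra k N) :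
    Winding.leftAut χ (E.incl k c) ∈ Set.range (E.incl k) := by
  change _ ∈ (E.incl k).range
  induction c using MonoidAlgebra.induction_on with
  | of n =>
    refine ⟨MonoidAlgebra.single n (χ (MonoidAlgebra.single (E.inl n) 1)), ?_⟩
    change _ = Winding.leftHom χ _
    simp [MonoidAlgebra.of_apply, Winding.leftHom_single]
  | add x y hx hy => rw [map_add, map_add]; exact add_mem hx hy
  | smul r x hx => rw [map_smul, map_smul]; exact Subalgebra.smul_mem _ hx r

theorem leftAut_symm (χ : MonoidAlgebra k G →ₐ[k] k) :
    (Winding.leftAut χ).symm = Winding.leftAut (Winding.invChar χ) := by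
  refine AlgEquiv.coe_toAlgHom_injective ?_
  refine MonoidAlgebra.algHom_ext (fun g => ?_) (Subsingleton.elim _ _)
  rfl

theorem leftAut_mem_relAut (χ : MonoidAlgebra k G →ₐ[k] k) : Winding.leftAut χ ∈ E.relAut k := by
  change Winding.leftAut χ '' _ = _
  refine Set.Subset.antisymm ?_ ?_
  · rintro _ ⟨_, ⟨c, rfl⟩, rfl⟩
    exact E.leftAut_comp_incl_mem_range χ c
  · rintro _ ⟨c, rfl⟩
    refine ⟨(Winding.leftAut χ).symm (E.incl k c), ?_, AlgEquiv.apply_symm_apply _ _⟩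
    rw [leftAut_symm]
    exact E.leftAut_comp_incl_mem_range _ c

/-- The image of the augmentation ideal under `φ` is the kernel of the character `ε ∘ φ⁻¹` of
`C`. -/
theorem eq_ker_of_image_augIdeal {φ : MonoidAlgebra k G ≃ₐ[k] MonoidAlgebra k G}
    (hφ : φ ∈ E.relAut k) {m : Ideal (MonoidAlgebra k N)} :
    E.incl k '' (m : Set (MonoidAlgebra k N)) =
        φ '' (E.incl k '' (augIdeal k N : Set (MonoidAlgebra k N))) ↔
      m = RingHom.ker (((Bialgebra.counitAlgHom k (MonoidAlgebra k G)).comp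
        φ.symm.toAlgHom).comp (E.incl k)) := by
  have hε : ∀ c : MonoidAlgebra k N, Bialgebra.counitAlgHom k (MonoidAlgebra k G) (E.incl k c) =
      Bialgebra.counitAlgHom k (MonoidAlgebra k N) c := by
    refine DFunLike.congr_fun (f := (Bialgebra.counitAlgHom k (MonoidAlgebra k G)).comp
      (E.incl k)) ?_
    refine MonoidAlgebra.algHom_ext (fun n => ?_) (Subsingleton.elim _ _)
    simp
  -- Because `φ(C) = C`, both `φ` and its inverse may be followed on elements of `C`.
  have key : φ '' (E.incl k '' (augIdeal k N : Set (MonoidAlgebra k N))) =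
      E.incl k '' (RingHom.ker (((Bialgebra.counitAlgHom k (MonoidAlgebra k G)).comp
        φ.symm.toAlgHom).comp (E.incl k)) : Set (MonoidAlgebra k N)) := by
    ext x
    constructor
    · rintro ⟨_, ⟨c, hc, rfl⟩, rfl⟩
      obtain ⟨d, hd⟩ : φ (E.incl k c) ∈ Set.range (E.incl k) := by
        rw [← show φ '' _ = _ from hφ]
        exact ⟨_, ⟨c, rfl⟩, rfl⟩
      refine ⟨d, ?_, hd⟩
      change Bialgebra.counitAlgHom k (MonoidAlgebra k G) (φ.symm (E.incl k d)) = 0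
      rw [hd, AlgEquiv.symm_apply_apply, hε]
      exact hc
    · rintro ⟨d, hd, rfl⟩
      obtain ⟨_, ⟨c, rfl⟩, hc⟩ : E.incl k d ∈ φ '' Set.range (E.incl k) := by
        rw [show φ '' _ = _ from hφ]
        exact ⟨d, rfl⟩
      refine ⟨_, ⟨c, ?_, rfl⟩, hc⟩
      change Bialgebra.counitAlgHom k (MonoidAlgebra k G) (φ.symm (E.incl k d)) = 0 at hd
      rw [← hc, AlgEquiv.symm_apply_apply, hε] at hd
      exact hd
  rw [key, (Set.image_injective.2 E.incl_injective).eq_iff, SetLike.coe_set_eq]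

/-- Every character of `H` has the form `ε ∘ φ⁻¹` with `φ` a winding automorphism; the convolution
inverse of `χ` compensates for the inverse of `φ`. -/
theorem counit_comp_leftAut_symm_invChar (χ : MonoidAlgebra k G →ₐ[k] k) :
    (Bialgebra.counitAlgHom k (MonoidAlgebra k G)).comp
      (Winding.leftAut (Winding.invChar χ)).symm.toAlgHom = χ := by
  refine MonoidAlgebra.algHom_ext (fun g => ?_) (Subsingleton.elim _ _)
  change Bialgebra.counitAlgHom k (MonoidAlgebra k G)
    (Winding.leftHom (Winding.invChar (Winding.invChar χ)) (MonoidAlgebra.single g 1)) = _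
  rw [Winding.leftHom_single, Winding.invChar_single, Winding.invChar_single, inv_inv]
  simp

theorem orbit_relAut :
    E.orbit (E.relAut k) (augIdeal k N) =
      Set.range fun χ : MonoidAlgebra k G →ₐ[k] k => RingHom.ker (χ.comp (E.incl k)) := by
  ext m
  constructor
  · rintro ⟨φ, hφ, h⟩
    exact ⟨_, ((E.eq_ker_of_image_augIdeal hφ).1 h).symm⟩
  · rintro ⟨χ, rfl⟩
    refine ⟨Winding.leftAut (Winding.invChar χ), E.leftAut_mem_relAut _,
      (E.eq_ker_of_image_augIdeal (E.leftAut_mem_relAut _)).2 ?_⟩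
    rw [counit_comp_leftAut_symm_invChar]

theorem orbit_leftAut :
    E.orbit (Set.range Winding.leftAut) (augIdeal k N) =
      Set.range fun χ : MonoidAlgebra k G →ₐ[k] k => RingHom.ker (χ.comp (E.incl k)) := by
  refine Set.Subset.antisymm ?_ ?_
  · rw [← orbit_relAut]
    rintro m ⟨_, ⟨χ, rfl⟩, h⟩
    exact ⟨_, E.leftAut_mem_relAut χ, h⟩
  · rintro _ ⟨χ, rfl⟩
    refine ⟨Winding.leftAut (Winding.invChar χ), ⟨_, rfl⟩,
      (E.eq_ker_of_image_augIdeal (E.leftAut_mem_relAut _)).2 ?_⟩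
    rw [counit_comp_leftAut_symm_invChar]

end CentralExtension

/-! ### The convolution group of characters of `N/A`, and the assembly. -/

/-- Composition with the projection `k[N] → k[N/A]`, as a homomorphism of character groups. -/
noncomputable def MonoidAlgebra.compMkHom (k : Type*) {N : Type*} [Field k] [CommGroup N]
    (A : Subgroup N) : WithConv (MonoidAlgebra k (N ⧸ A) →ₐ[k] k) →*
      WithConv (MonoidAlgebra k N →ₐ[k] k) where
  toFun ψ := WithConv.toConv
    (ψ.ofConv.comp (MonoidAlgebra.mapDomainAlgHom k k (QuotientGroup.mk' A)))
  map_one' := by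
    refine WithConv.ofConv_injective (MonoidAlgebra.algHom_ext (fun n => ?_) (Subsingleton.elim _ _))
    change (1 : WithConv (MonoidAlgebra k (N ⧸ A) →ₐ[k] k)) (MonoidAlgebra.mapDomainAlgHom k k _ _) =
      (1 : WithConv (MonoidAlgebra k N →ₐ[k] k)) _
    simp [AlgHom.convOne_apply]
  map_mul' ψ ψ' := by
    refine WithConv.ofConv_injective (MonoidAlgebra.algHom_ext (fun n => ?_) (Subsingleton.elim _ _))
    change (ψ * ψ') (MonoidAlgebra.mapDomainAlgHom k k _ _) = (WithConv.toConv
      (ψ.ofConv.comp (MonoidAlgebra.mapDomainAlgHom k k (QuotientGroup.mk' A))) * WithConv.toConv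
      (ψ'.ofConv.comp (MonoidAlgebra.mapDomainAlgHom k k (QuotientGroup.mk' A)))) _
    rw [MonoidAlgebra.convMul_algHom_single_one]
    simp

theorem MonoidAlgebra.compMkHom_injective (k : Type*) {N : Type*} [Field k] [CommGroup N]
    (A : Subgroup N) : Function.Injective (MonoidAlgebra.compMkHom k A) := by
  intro ψ ψ' h
  refine WithConv.ofConv_injective (MonoidAlgebra.algHom_ext (fun x => ?_) (Subsingleton.elim _ _))
  obtain ⟨n, rfl⟩ := QuotientGroup.mk_surjective x
  have := congr(($h).ofConv (MonoidAlgebra.single n 1))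
  simpa [MonoidAlgebra.compMkHom] using this

theorem corollaryB {k : Type*} [Field k] [IsAlgClosed k]
    {N G Q : Type*} [CommGroup N] [Group.FG N] [Group G] [CommGroup Q] [Finite Q]
    (E : CentralExtension N G Q) (hchar : ringChar k ∉ Set.Icc 1 (Nat.card Q)) :
    -- the fiber algebras
    (∀ (m : Ideal (MonoidAlgebra k N)), m.IsMaximal →
      ∀ (V : Type*) [AddCommGroup V] [Module k V] [Module (E.Fiber m) V]
        [IsScalarTower k (E.Fiber m) V], IsSimpleModule (E.Fiber m) V →
        FiniteDimensional k V ∧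
        ∃ r : ℕ, r * Module.finrank k V ^ 2 = Nat.card Q ∧
          Nonempty (E.Fiber m ≃ₐ[k]
            (Fin r → Matrix (Fin (Module.finrank k V)) (Fin (Module.finrank k V)) k))) ∧
    -- maximal stability
    (∀ (V : Type*) [AddCommGroup V] [Module k V] [Module (MonoidAlgebra k G) V]
        [IsScalarTower k (MonoidAlgebra k G) V], IsSimpleModule (MonoidAlgebra k G) V →
        E.MaximallyStable k V) ∧
    -- the orbit of the augmentation ideal
    (∃ A : Subgroup N,
      (∀ x y : G ⧸ A.map E.inl, x * y = y * x) ∧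
      E.orbit (E.relAut k) (augIdeal k N) =
        E.orbit (Set.range Winding.leftAut) (augIdeal k N) ∧
      E.orbit (Set.range Winding.leftAut) (augIdeal k N) =
        E.orbit (Set.range Winding.rightAut) (augIdeal k N) ∧
      ∃ P : Subgroup (WithConv (MonoidAlgebra k N →ₐ[k] k)),
        (fun χ : WithConv (MonoidAlgebra k N →ₐ[k] k) => RingHom.ker χ.ofConv) '' P =
          E.orbit (E.relAut k) (augIdeal k N) ∧
        ∃ e : WithConv (MonoidAlgebra k (N ⧸ A) →ₐ[k] k) ≃* P,
          ∀ ψ, (e ψ : WithConv (MonoidAlgebra k N →ₐ[k] k)).ofConv =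
            ψ.ofConv.comp (MonoidAlgebra.mapDomainAlgHom k k (QuotientGroup.mk' A))) := by
  have hQ : (Nat.card Q : k) ≠ 0 := by
    intro h
    -- A characteristic dividing `|Q| ≥ 1` is nonzero and lies in `[1, |Q|]`; characteristic zero is
    -- thereby allowed.
    have hd := ringChar.dvd h
    exact hchar ⟨Nat.pos_of_dvd_of_pos hd Nat.card_pos, Nat.le_of_dvd Nat.card_pos hd⟩
  refine ⟨fun m _ V _ _ _ _ _ => E.exists_fiber_algEquiv V hQ, fun V _ _ _ _ _ => ?_,
    E.commutatorComap, E.quotient_commutatorComap_mul_comm, ?_, ?_,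
    (MonoidAlgebra.compMkHom k E.commutatorComap).range, ?_,
    MonoidHom.ofInjective (MonoidAlgebra.compMkHom_injective k _), fun ψ => rfl⟩
  · have hV := E.actsByScalars_of_isSimpleModule (k := k) V
    have := hV.finiteDimensional
    exact E.maximallyStable_of_isSimpleModule V hV
  · rw [E.orbit_relAut, E.orbit_leftAut]
  · rw [CentralExtension.leftAut_eq_rightAut]
  · rw [E.orbit_relAut]
    ext m
    constructor
    · rintro ⟨_, ⟨ψ, rfl⟩, rfl⟩
      obtain ⟨χ, hχ⟩ := E.exists_extend_algHom ψ.ofConv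
      exact ⟨χ, congrArg RingHom.ker hχ⟩
    · rintro ⟨χ, rfl⟩
      obtain ⟨ψ, hψ⟩ := E.exists_descend_algHom χ
      exact ⟨_, ⟨WithConv.toConv ψ, rfl⟩, congrArg RingHom.ker hψ⟩
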